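/- A \emph{limit sketch} is a small category $E$ with a set of specified cones $C_\alpha=(x_\alpha, I_\alpha,\phi_\alpha:I_\alpha\to E,\delta_\alpha:*_{x_\alpha}\Rightarrow\phi_\alpha)$, $\alpha\in A$, where each $I_\alpha$ is a small category and $*_x$ is the constant diagram at $x$, such that for every object $e$ of $E$ the trivial cone $(e,\mathbf 1,*_e,\mathrm{id})$ is among the $C_\alpha$. It is \emph{realized} if every specified cone is a limit cone. A \emph{model} of the sketch is a functor $E\to\mathbf{Set}$ that sends all specified cones to limit cones; models form a full subcategory $\mathrm{Mod}(E)$ of $[E,\mathbf{Set}]$. For $y\in\mathrm{ob}\,E$ and $\alpha\in A$, let $i_{y,\alpha}:E\to E[y;\alpha]$ be the category obtained from $E$ by freely adjoining morphisms $\gamma_i:y\to\phi_\alpha(i)$ ($i\in \mathrm{ob}\, I_\alpha$) subject to $\phi_\alpha(f)\circ\gamma_i=\gamma_j$ for all $f:i\to j$ in $I_\alpha$, and let $r_{y,\alpha}:E[y;\alpha]\to E[y;\alpha]'$ be the category obtained from $E[y;\alpha]$ by freely adjoining a morphism $\bar\gamma:y\to x_\alpha$ subject to $(\delta_\alpha)_i\circ\bar\gamma=\gamma_i$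 for all $i$. Let $\Xi$ be the set of all the maps $r_{y,\alpha}$, regarded as maps of the coslice category $E/\mathbf{Cat}$. Call $f$ \emph{left orthogonal} to $g$, and $g$ \emph{right orthogonal} to $f$, if every commutative square from $f$ to $g$ has a unique lifting. Let $\mathcal R$ be the class of maps of $E/\mathbf{Cat}$ that are right orthogonal to every map in $\Xi$, and let $\mathcal L$ be the class of maps that are left orthogonal to every map in $\mathcal R$. The \emph{universal realization} $\lambda_!:E\to \mathrm{Fr}(E)$ is the category with the same objects as $E$ whose morphisms are generated under composition by the morphisms of $E$ and by fillers $y\to x_\alpha$, one for each cone over $\phi_\alpha$ (with vertex $y$) of morphisms so generated, subject to the equations that make it a category, make $\lambda_!$ a functor, and make each filler the unique factorization of its cone through $\lambda_!\delta_\alpha$. It is a limit sketch with the specified cones $\lambda_!C_\alpha$, $\alpha\in A$. \textbf{Lemma.} Let $E$ be a limit sketch. \begin{enumerate} \item $E\xrightarrow{\lambda_!}\mathrm{Fr}(E)\xrightarrow{!}*$ is the $(\mathcal L,\mathcal R)$-factorization in $E/\mathbf{Cat}$ of the map from the object $1_E$ to the terminal object, that is, $\lambda_!\in\mathcal L$ and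 $!\in\mathcal R$; and the limit sketch $\mathrm{Fr}(E)$ is realized. \item Precomposition with $\lambda_!$ is a bijection on objects \[ \lambda_!^*:\mathrm{ob}(\mathrm{Mod}(\mathrm{Fr}(E)))\to\mathrm{ob}(\mathrm{Mod}(E)). \] \item Its inverse $\Phi$ sends a model $X:E\to\mathbf{Set}$ to the unique functor $\Phi(X):\mathrm{Fr}(E)\to\mathbf{Set}$ with $\Phi(X)\circ\lambda_!=X$; in particular this functor is a model. \end{enumerate} -/

import Mathlib

open CategoryTheory CategoryTheory.Limits

universe u

/-- A cone in a category `E`: a small category `I`, a diagram `φ : I ⥤ E`, and a cone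
(an apex together with a natural transformation from the constant diagram) over `φ`. -/
structure SketchCone (E : Type u) [SmallCategory E] where
  I : Type u
  [catI : SmallCategory I]
  φ : I ⥤ E
  cone : Cone φ

attribute [instance] SketchCone.catI

namespace SketchCone

/-- The cone `(e, 1, *_e, id)` over the constant diagram indexed by the terminal category. -/
def trivial {E : Type u} [SmallCategory E] (e : E) : SketchCone E where
  I := Discrete PUnit.{u + 1}
  φ := (Functor.const _).obj e
  cone := { pt := e, π := 𝟙 _ }

/-- The image of a cone under a functor. -/
def map {E D : Type u} [SmallCategory E] [SmallCategory D] (F : E ⥤ D) (c : SketchCone E) :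
    SketchCone D where
  I := c.I
  φ := c.φ ⋙ F
  cone := F.mapCone c.cone

theorem mk_congr {E : Type u} [SmallCategory E] {I : Type u} [SmallCategory I] {φ ψ : I ⥤ E}
    (h : φ = ψ) (c : Cone φ) (d : Cone ψ) (hpt : c.pt = d.pt)
    (hπ : ∀ i, c.π.app i ≫ eqToHom (by rw [h]) = eqToHom hpt ≫ d.π.app i) :
    (SketchCone.mk I φ c : SketchCone E) = SketchCone.mk I ψ d := by
  subst h
  obtain ⟨x, a⟩ := c
  obtain ⟨y, b⟩ := d
  dsimp at hpt
  subst hpt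
  have : a = b := by
    ext i
    simpa using hπ i
  rw [this]

theorem map_trivial {E D : Type u} [SmallCategory E] [SmallCategory D] (F : E ⥤ D) (e : E) :
    (trivial e).map F = trivial (F.obj e) := by
  have h : (Functor.const (Discrete PUnit.{u + 1})).obj e ⋙ F =
      (Functor.const (Discrete PUnit.{u + 1})).obj (F.obj e) :=
    CategoryTheory.Functor.ext (fun _ => rfl) fun i j f => by
      simp only [Functor.comp_map, Functor.const_obj_map, eqToHom_refl, Category.comp_id]
      exact (F.map_id e).trans (Category.comp_id (𝟙 (F.obj e))).symm
  refine mk_congr h _ _ rfl fun i => ?_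
  exact (Category.comp_id _).trans ((F.map_id e).trans (Category.comp_id _).symm)

end SketchCone

/-- A (small) limit sketch: a small category together with a small family of cones in it, among
which are all the trivial cones `(e, 1, *_e, id)`. -/
structure LimitSketch where
  Ob : Type u
  [cat : SmallCategory Ob]
  A : Type u
  cone : A → SketchCone Ob
  trivial_mem : ∀ e : Ob, ∃ α : A, cone α = SketchCone.trivial e

attribute [instance] LimitSketch.cat

/-! ### Freely adjoining morphisms to a category, subject to relations -/

section Adjoin

/-- The graph obtained from the underlying graph of `C` by adding the edges `K`. -/
structure AdjQuiver (C : Type u) [SmallCategory C] (K : C → C → Type u) : Type u where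
  as : C

instance (C : Type u) [SmallCategory C] (K : C → C → Type u) : Quiver.{u} (AdjQuiver C K) where
  Hom a b := (a.as ⟶ b.as) ⊕ K a.as b.as

variable {C : Type u} [SmallCategory C] {K : C → C → Type u}

/-- A morphism of `C`, as a path of length one in `AdjQuiver C K`. -/
def AdjQuiver.old {x y : C} (f : x ⟶ y) :
    (Paths.of (AdjQuiver C K)).obj ⟨x⟩ ⟶ (Paths.of (AdjQuiver C K)).obj ⟨y⟩ :=
  (Paths.of (AdjQuiver C K)).map (X := ⟨x⟩) (Y := ⟨y⟩) (Sum.inl f)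

/-- An added edge, as a path of length one in `AdjQuiver C K`. -/
def AdjQuiver.new {x y : C} (k : K x y) :
    (Paths.of (AdjQuiver C K)).obj ⟨x⟩ ⟶ (Paths.of (AdjQuiver C K)).obj ⟨y⟩ :=
  (Paths.of (AdjQuiver C K)).map (X := ⟨x⟩) (Y := ⟨y⟩) (Sum.inr k)

/-- The relations making `C` map functorially (they present the pushout of the counit
`Free (U C) ⥤ C` along `Free (U C) ⥤ Free (AdjQuiver C K)`), together with further relations `R`. -/
inductive AdjRel (R : HomRel (Paths (AdjQuiver C K))) : HomRel (Paths (AdjQuiver C K))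
  | id (x : C) : AdjRel R (AdjQuiver.old (𝟙 x)) (𝟙 _)
  | comp {x y z : C} (f : x ⟶ y) (g : y ⟶ z) :
      AdjRel R (AdjQuiver.old (f ≫ g)) (AdjQuiver.old f ≫ AdjQuiver.old g)
  | rel {x y : Paths (AdjQuiver C K)} (p q : x ⟶ y) : R p q → AdjRel R p q

/-- The category obtained from `C` by freely adjoining the edges `K` and imposing `R`. -/
abbrev Adjoin (R : HomRel (Paths (AdjQuiver C K))) : Type u :=
  CategoryTheory.Quotient (AdjRel R)

/-- The canonical functor from `C`, the identity on objects. -/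
def Adjoin.incl (R : HomRel (Paths (AdjQuiver C K))) : C ⥤ Adjoin R where
  obj x := (Quotient.functor (AdjRel R)).obj ((Paths.of (AdjQuiver C K)).obj ⟨x⟩)
  map f := (Quotient.functor (AdjRel R)).map (AdjQuiver.old f)
  map_id x := by
    rw [← CategoryTheory.Functor.map_id]
    exact CategoryTheory.Quotient.sound _ (AdjRel.id x)
  map_comp f g := by
    rw [← CategoryTheory.Functor.map_comp]
    exact CategoryTheory.Quotient.sound _ (AdjRel.comp f g)

/-- The morphism of `Adjoin R` given by an added edge. -/
def Adjoin.edge (R : HomRel (Paths (AdjQuiver C K))) {x y : C} (k : K x y) :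
    (Adjoin.incl R).obj x ⟶ (Adjoin.incl R).obj y :=
  (Quotient.functor (AdjRel R)).map (AdjQuiver.new k)

end Adjoin

/-! ### Unique orthogonality -/

section Orthogonality

variable {C : Type*} [Category* C]

/-- `f ↓ g`: every commutative square from `f` to `g` has a unique lifting. -/
def UniquelyOrthogonal {x y a b : C} (f : x ⟶ y) (g : a ⟶ b) : Prop :=
  ∀ (i : x ⟶ a) (j : y ⟶ b), i ≫ g = f ≫ j → ∃! h : y ⟶ a, f ≫ h = i ∧ h ≫ g = j

/-- The morphisms `g` with `h ↓ g` for all `h` in `H`. -/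
def orthRight (H : MorphismProperty C) : MorphismProperty C :=
  fun _ _ g => ∀ ⦃x y : C⦄ (h : x ⟶ y), H h → UniquelyOrthogonal h g

/-- The morphisms `f` with `f ↓ h` for all `h` in `H`. -/
def orthLeft (H : MorphismProperty C) : MorphismProperty C :=
  fun _ _ f => ∀ ⦃x y : C⦄ (h : x ⟶ y), H h → UniquelyOrthogonal f h

end Orthogonality

namespace LimitSketch

variable (S : LimitSketch.{u})

/-- The indexing category of the cone `α`. -/
abbrev I (α : S.A) : Type u := (S.cone α).I

/-- The diagram of the cone `α`. -/
abbrev φ (α : S.A) : S.I α ⥤ S.Ob := (S.cone α).φ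

/-- The apex of the cone `α`. -/
abbrev x (α : S.A) : S.Ob := (S.cone α).cone.pt

/-- The legs of the cone `α`. -/
abbrev δ (α : S.A) (i : S.I α) : S.x α ⟶ (S.φ α).obj i := (S.cone α).cone.π.app i

/-! ### The categories `E[y;α]` and `E[y;α]'`, and the set `Ξ` of maps in `E/Cat` -/

/-- The new edges `γ_i : y ⟶ φ_α(i)`. -/
inductive CoinsEdge (y : S.Ob) (α : S.A) : S.Ob → S.Ob → Type u
  | γ (i : S.I α) : CoinsEdge y α y ((S.φ α).obj i)

/-- The relations `φ_α(f) ∘ γ_i ∼ γ_j`. -/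
inductive CoinsRel (y : S.Ob) (α : S.A) : HomRel (Paths (AdjQuiver S.Ob (S.CoinsEdge y α)))
  | nat {i j : S.I α} (f : i ⟶ j) :
      CoinsRel y α (AdjQuiver.new (CoinsEdge.γ i) ≫ AdjQuiver.old ((S.φ α).map f))
        (AdjQuiver.new (CoinsEdge.γ j))

/-- `E[y;α]`: the category obtained from `E` by freely adjoining a cone `γ` from `y` over `φ_α`. -/
abbrev Coins (y : S.Ob) (α : S.A) : Type u := Adjoin (S.CoinsRel y α)

/-- The functor `i_{y,α} : E ⥤ E[y;α]`. -/
abbrev coinsIncl (y : S.Ob) (α : S.A) : S.Ob ⥤ S.Coins y α := Adjoin.incl _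

/-- The new edge from `y` to `x_α`. -/
inductive FillEdge (y : S.Ob) (α : S.A) : S.Coins y α → S.Coins y α → Type u
  | γbar : FillEdge y α ((S.coinsIncl y α).obj y) ((S.coinsIncl y α).obj (S.x α))

/-- The relations `(δ_α)_i ∘ γbar ∼ γ_i`. -/
inductive FillRel (y : S.Ob) (α : S.A) :
    HomRel (Paths (AdjQuiver (S.Coins y α) (S.FillEdge y α)))
  | fac (i : S.I α) :
      FillRel y α
        (AdjQuiver.new FillEdge.γbar ≫ AdjQuiver.old ((S.coinsIncl y α).map (S.δ α i)))
        (AdjQuiver.old (Adjoin.edge (S.CoinsRel y α) (CoinsEdge.γ i)))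

/-- `E[y;α]'`: the category obtained from `E[y;α]` by freely adjoining a factorization of the cone
`γ` through the cone `δ_α`. -/
abbrev Fill (y : S.Ob) (α : S.A) : Type u := Adjoin (S.FillRel y α)

/-- The functor `r_{y,α} : E[y;α] ⥤ E[y;α]'`. -/
abbrev fillIncl (y : S.Ob) (α : S.A) : S.Coins y α ⥤ S.Fill y α := Adjoin.incl _

/-- The coslice category `E/Cat`. -/
abbrev Coslice : Type (u + 1) := Under (Cat.of S.Ob : Cat.{u, u})

/-- A functor out of `E` as an object of `E/Cat`. -/
abbrev underMk {D : Type u} [SmallCategory D] (F : S.Ob ⥤ D) : S.Coslice :=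
  Under.mk (Y := Cat.of D) F.toCatHom

/-- A functor commuting with functors from `E`, as a morphism of `E/Cat`. -/
abbrev underHom {D D' : Type u} [SmallCategory D] [SmallCategory D'] {F : S.Ob ⥤ D}
    {F' : S.Ob ⥤ D'} (G : D ⥤ D') (h : F ⋙ G = F') : S.underMk F ⟶ S.underMk F' :=
  Under.homMk G.toCatHom (Cat.Hom.ext h)

/-- The map `r_{y,α} : (E[y;α], i_{y,α}) ⟶ (E[y;α]', j_{y,α})` of `E/Cat`. -/
def rMap (y : S.Ob) (α : S.A) :
    S.underMk (S.coinsIncl y α) ⟶ S.underMk (S.coinsIncl y α ⋙ S.fillIncl y α) :=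
  S.underHom (S.fillIncl y α) rfl

/-- The set `Ξ` of all the maps `r_{y,α}`. -/
def Xi : MorphismProperty S.Coslice :=
  MorphismProperty.ofHoms fun p : S.Ob × S.A => S.rMap p.1 p.2

/-! ### The universal realization `Fr(E)`

Its objects are those of `E`. Its morphisms are the formal expressions built from morphisms of `E`
by composition and by fillers of cones over the diagrams `φ_α`, modulo the equations of a category
in which the specified cones are limit cones. A filler makes sense only for a family of expressions
that is a cone modulo these equations, so the equations are given by a partial equivalence relation:
`Rel f f` expresses that `f` is a meaningful expression. -/

/-- Raw expressions for the morphisms of `Fr(E)`. -/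
inductive PreHom : S.Ob → S.Ob → Type u
  | of {a b : S.Ob} (f : a ⟶ b) : PreHom a b
  | comp {a b c : S.Ob} (f : PreHom a b) (g : PreHom b c) : PreHom a c
  | lift (α : S.A) {y : S.Ob} (κ : ∀ i : S.I α, PreHom y ((S.φ α).obj i)) : PreHom y (S.x α)

/-- The smallest partial equivalence relation expressing meaningfulness and equality of raw
expressions. -/
inductive Rel : ∀ {a b : S.Ob}, S.PreHom a b → S.PreHom a b → Prop
  | symm {a b : S.Ob} {f g : S.PreHom a b} : Rel f g → Rel g f
  | trans {a b : S.Ob} {f g h : S.PreHom a b} : Rel f g → Rel g h → Rel f h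
  | of {a b : S.Ob} (f : a ⟶ b) : Rel (PreHom.of f) (PreHom.of f)
  | comp {a b c : S.Ob} {f f' : S.PreHom a b} {g g' : S.PreHom b c} :
      Rel f f' → Rel g g' → Rel (f.comp g) (f'.comp g')
  | id_comp {a b : S.Ob} {f : S.PreHom a b} : Rel f f → Rel ((PreHom.of (𝟙 a)).comp f) f
  | comp_id {a b : S.Ob} {f : S.PreHom a b} : Rel f f → Rel (f.comp (PreHom.of (𝟙 b))) f
  | assoc {a b c d : S.Ob} {f : S.PreHom a b} {g : S.PreHom b c} {h : S.PreHom c d} :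
      Rel f f → Rel g g → Rel h h → Rel ((f.comp g).comp h) (f.comp (g.comp h))
  | of_comp {a b c : S.Ob} (f : a ⟶ b) (g : b ⟶ c) :
      Rel (PreHom.of (f ≫ g)) ((PreHom.of f).comp (PreHom.of g))
  | lift (α : S.A) {y : S.Ob} {κ κ' : ∀ i : S.I α, S.PreHom y ((S.φ α).obj i)} :
      (∀ i, Rel (κ i) (κ' i)) →
      (∀ {i j : S.I α} (u : i ⟶ j), Rel ((κ i).comp (PreHom.of ((S.φ α).map u))) (κ j)) →
      Rel (PreHom.lift α κ) (PreHom.lift α κ')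
  | fac (α : S.A) {y : S.Ob} {κ : ∀ i : S.I α, S.PreHom y ((S.φ α).obj i)} :
      (∀ i, Rel (κ i) (κ i)) →
      (∀ {i j : S.I α} (u : i ⟶ j), Rel ((κ i).comp (PreHom.of ((S.φ α).map u))) (κ j)) →
      ∀ i : S.I α, Rel ((PreHom.lift α κ).comp (PreHom.of (S.δ α i))) (κ i)
  | uniq (α : S.A) {y : S.Ob} {f g : S.PreHom y (S.x α)} :
      Rel f f → Rel g g →
      (∀ i : S.I α, Rel (f.comp (PreHom.of (S.δ α i))) (g.comp (PreHom.of (S.δ α i)))) →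
      Rel f g

/-- The objects of `Fr(E)` are those of `E`. -/
@[ext]
structure FrOb : Type u where
  as : S.Ob

/-- Equality of meaningful expressions. -/
def frSetoid (a b : S.Ob) : Setoid {f : S.PreHom a b // S.Rel f f} where
  r f g := S.Rel f.1 g.1
  iseqv := ⟨fun f => f.2, fun h => h.symm, fun h h' => h.trans h'⟩

instance : SmallCategory S.FrOb where
  Hom a b := _root_.Quotient (S.frSetoid a.as b.as)
  id a := Quotient.mk (S.frSetoid _ _) ⟨PreHom.of (𝟙 a.as), Rel.of _⟩
  comp {a b c} f g :=
    Quotient.map₂ (sa := S.frSetoid a.as b.as) (sb := S.frSetoid b.as c.as)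
      (sc := S.frSetoid a.as c.as)
      (fun f g => ⟨f.1.comp g.1, Rel.comp f.2 g.2⟩) (fun _ _ h _ _ h' => Rel.comp h h') f g
  id_comp f := by
    induction f using Quotient.inductionOn with
    | h f => exact Quotient.sound (Rel.id_comp f.2)
  comp_id f := by
    induction f using Quotient.inductionOn with
    | h f => exact Quotient.sound (Rel.comp_id f.2)
  assoc f g h := by
    induction f using Quotient.inductionOn with
    | h f =>
      induction g using Quotient.inductionOn with
      | h g =>
        induction h using Quotient.inductionOn with
        | h h => exact Quotient.sound (Rel.assoc f.2 g.2 h.2)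

/-- The functor `λ_! : E ⥤ Fr(E)`. -/
def lam : S.Ob ⥤ S.FrOb where
  obj a := ⟨a⟩
  map f := Quotient.mk (S.frSetoid _ _) ⟨PreHom.of f, Rel.of f⟩
  map_id _ := rfl
  map_comp f g := Quotient.sound (Rel.of_comp f g)

/-- The universal realization `Fr(E)` as a limit sketch; its specified cones are the images under
`λ_!` of those of `E`. -/
def Fr : LimitSketch.{u} where
  Ob := S.FrOb
  A := S.A
  cone α := (S.cone α).map S.lam
  trivial_mem := by
    rintro ⟨e⟩
    obtain ⟨α, hα⟩ := S.trivial_mem e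
    exact ⟨α, by rw [hα, SketchCone.map_trivial]; rfl⟩

/-- A limit sketch is realized if its specified cones are limit cones. -/
def IsRealized : Prop := ∀ α : S.A, Nonempty (IsLimit (S.cone α).cone)

/-- The map `λ_! : (E, 1_E) ⟶ (Fr(E), λ_!)` of `E/Cat`. -/
def lamMap : S.underMk (𝟭 S.Ob) ⟶ S.underMk S.lam :=
  S.underHom S.lam (Functor.id_comp _)

/-- The map from `(Fr(E), λ_!)` to the terminal object of `E/Cat`. -/
def frToTerminal : S.underMk S.lam ⟶
    S.underMk ((Functor.const S.Ob).obj (Discrete.mk PUnit.unit.{u + 1})) :=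
  S.underHom ((Functor.const S.FrOb).obj (Discrete.mk PUnit.unit)) rfl

/-! ### Models -/

/-- A functor `E ⥤ Set` is a model if it sends the specified cones to limit cones. -/
def IsModel : ObjectProperty (S.Ob ⥤ Type u) :=
  fun M => ∀ α : S.A, Nonempty (IsLimit (M.mapCone (S.cone α).cone))

/-- The category of models, a full subcategory of `[E, Set]`. -/
abbrev Mod : Type (u + 1) := S.IsModel.FullSubcategory

/-- Precomposition with `λ_!`, on the objects of the categories of models. -/
def lamStar (M : S.Fr.Mod) : S.Mod where
  obj := S.lam ⋙ M.obj
  property α := M.property α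

end LimitSketch

/-! Everything reduces to one concrete condition, `HasUniqueFillers F G`: a cone over some `F φ_α`
with vertex `F y`, together with a factorization of its `G`-image through `G F δ_α`, has exactly one
factorization through `F δ_α` lying over the given one. A map of `E/Cat` in the right class
satisfies it, because a cone with a prescribed factorization of its image is the same as a square
out of `r_{y,α}`, and the filler is the image of `γbar` under the lift. Over the terminal category
the condition on the image is vacuous, so it holds as soon as the specified cones become limit
cones.

The heart is `existsUnique_fr_functor`: if `F : E ⥤ D` has unique fillers relative to `G : D ⥤ D'`,
then each `J` on `Fr(E)` with `J λ_! = G F` lifts uniquely to `H` with `H λ_! = F` and `G H = J`. On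
morphisms of `E` the value of `H` is given by `F`; on composites it is forced; on a filler it is the
unique filler in `D` lying over the value of `J`. Each equation imposed in `Fr(E)` holds for these
values.

With `G` in the right class, this is the left orthogonality of `λ_!`. With `D` the category of sets
and `G` the functor to the point, it says that a model extends uniquely along `λ_!`. The extension
is a model because its restriction is one. `Fr(E)` is realized because the rules `lift`, `fac` and
`uniq` say just that, which also puts `Fr(E) ⟶ *` in the right class. -/

/-! ### The universal property of `Adjoin` -/

namespace Adjoin

universe v w

variable {C : Type u} [SmallCategory C] {K : C → C → Type u} {D : Type v} [Category.{w} D]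

/-- The functor out of the free category on `AdjQuiver C K` given by a functor on `C` and the
images of the added edges. -/
def pathsDesc (F : C ⥤ D) (k : ∀ {x y : C}, K x y → (F.obj x ⟶ F.obj y)) :
    Paths (AdjQuiver C K) ⥤ D :=
  Paths.lift
    { obj := fun a => F.obj a.as
      map := fun {_ _} e => Sum.elim (fun f => F.map f) (fun e => k e) e }

section

variable (F : C ⥤ D) (k : ∀ {x y : C}, K x y → (F.obj x ⟶ F.obj y))

theorem pathsDesc_old {x y : C} (f : x ⟶ y) :
    (pathsDesc F k).map (AdjQuiver.old f) = F.map f :=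
  Category.id_comp _

theorem pathsDesc_new {x y : C} (e : K x y) :
    (pathsDesc F k).map (AdjQuiver.new e) = k e :=
  Category.id_comp _

variable {R : HomRel (Paths (AdjQuiver C K))}
  (hR : ∀ ⦃x y : Paths (AdjQuiver C K)⦄ (p q : x ⟶ y), R p q →
    (pathsDesc F k).map p = (pathsDesc F k).map q)

/-- The functor out of `Adjoin R` given by a functor on `C` and images of the added edges
satisfying the relations `R`. -/
def desc : Adjoin R ⥤ D :=
  CategoryTheory.Quotient.lift _ (pathsDesc F k) (by
    intro x y p q h
    cases h with
    | id x =>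
      rw [pathsDesc_old, F.map_id]
      exact ((pathsDesc F k).map_id _).symm
    | comp f g =>
      rw [Functor.map_comp, pathsDesc_old, pathsDesc_old, pathsDesc_old, F.map_comp]
      rfl
    | rel p q h => exact hR p q h)

theorem desc_incl_map {x y : C} (f : x ⟶ y) :
    (desc F k hR).map ((incl R).map f) = F.map f :=
  pathsDesc_old F k f

theorem desc_edge {x y : C} (e : K x y) : (desc F k hR).map (edge R e) = k e :=
  pathsDesc_new F k e

theorem incl_desc : incl R ⋙ desc F k hR = F :=
  CategoryTheory.Functor.ext (fun _ => rfl) fun x y f => by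
    refine (desc_incl_map F k hR f).trans ?_
    exact ((Category.id_comp _).trans (Category.comp_id _)).symm

end

/-- Two functors out of `Adjoin R` that agree on `C` and on the added edges are equal. -/
theorem functor_ext {R : HomRel (Paths (AdjQuiver C K))} {H H' : Adjoin R ⥤ D}
    (h : incl R ⋙ H = incl R ⋙ H')
    (he : ∀ {x y : C} (e : K x y), H.map (edge R e) ≍ H'.map (edge R e)) : H = H' := by
  refine CategoryTheory.Quotient.lift_unique' _ _ _ ?_
  refine Paths.ext_functor ?_ ?_
  · funext a
    exact Functor.congr_obj h a.as
  · rintro ⟨a⟩ ⟨b⟩ (f | e)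
    · exact Functor.congr_hom h f
    · have ha : H.obj ((incl R).obj a) = H'.obj ((incl R).obj a) := Functor.congr_obj h a
      have hb : H.obj ((incl R).obj b) = H'.obj ((incl R).obj b) := Functor.congr_obj h b
      exact (conj_eqToHom_iff_heq _ _ ha hb).2 (he e)

end Adjoin

namespace LimitSketch

variable (S : LimitSketch.{u})

/-! ### Orthogonality in `E/Cat` -/

section

variable {S}
variable {A B D D' : Type u} [SmallCategory A] [SmallCategory B] [SmallCategory D]
  [SmallCategory D'] {P : S.Ob ⥤ A} {Q : S.Ob ⥤ B} {F : S.Ob ⥤ D} {F' : S.Ob ⥤ D'}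

/-- Orthogonality in `E/Cat` in terms of functors. -/
theorem uniquelyOrthogonal_underHom_iff (p : A ⥤ B) (hp : P ⋙ p = Q) (g : D ⥤ D')
    (hg : F ⋙ g = F') :
    UniquelyOrthogonal (S.underHom p hp) (S.underHom g hg) ↔
      ∀ (i : A ⥤ D) (j : B ⥤ D'), P ⋙ i = F → i ⋙ g = p ⋙ j →
        ∃! h : B ⥤ D, p ⋙ h = i ∧ h ⋙ g = j := by
  subst hp hg
  constructor
  · intro H i j hi hij
    subst hi
    -- Compatibility of `j` with the functors from `E` is not assumed; it follows from the square
    -- and from compatibility of `i`.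
    obtain ⟨h, ⟨h₁, h₂⟩, hu⟩ := H (S.underHom i rfl)
      (S.underHom j (by rw [Functor.assoc, ← hij, Functor.assoc]))
      (by
        apply Under.UnderMorphism.ext
        exact Cat.Hom.ext hij)
    refine ⟨h.right.toFunctor, ⟨?_, ?_⟩, ?_⟩
    · exact congrArg (fun t => t.right.toFunctor) h₁
    · exact congrArg (fun t => t.right.toFunctor) h₂
    · rintro h' ⟨h₁', h₂'⟩
      have := hu (S.underHom h' (by rw [Functor.assoc, h₁']))
        ⟨Under.UnderMorphism.ext (Cat.Hom.ext h₁'), Under.UnderMorphism.ext (Cat.Hom.ext h₂')⟩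
      exact congrArg (fun t => t.right.toFunctor) this
  · intro H i j hij
    have hi : P ⋙ i.right.toFunctor = F := congrArg (fun t => t.toFunctor) (Under.w i)
    obtain ⟨h, ⟨h₁, h₂⟩, hu⟩ := H i.right.toFunctor j.right.toFunctor hi
      (congrArg (fun t => t.right.toFunctor) hij)
    refine ⟨S.underHom h ((congrArg (P ⋙ ·) h₁).trans hi),
      ⟨Under.UnderMorphism.ext (Cat.Hom.ext h₁), Under.UnderMorphism.ext (Cat.Hom.ext h₂)⟩, ?_⟩
    rintro h' ⟨h₁', h₂'⟩
    refine Under.UnderMorphism.ext (Cat.Hom.ext (hu _ ⟨?_, ?_⟩))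
    · exact congrArg (fun t => t.right.toFunctor) h₁'
    · exact congrArg (fun t => t.right.toFunctor) h₂'

end

/-! ### Unique fillers -/

section

universe v₁ w₁ v₂ w₂

variable {S} {D : Type v₁} [Category.{w₁} D] {D' : Type v₂} [Category.{w₂} D']

/-- Relative to `G`, every cone of the form `F φ_α` with vertex `F y` has a unique factorization
through `F δ_α` lying over a given factorization of its image. -/
def HasUniqueFillers (F : S.Ob ⥤ D) (G : D ⥤ D') : Prop :=
  ∀ (y : S.Ob) (α : S.A) (κ : ∀ i : S.I α, F.obj y ⟶ F.obj ((S.φ α).obj i)),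
    (∀ {i j : S.I α} (u : i ⟶ j), κ i ≫ F.map ((S.φ α).map u) = κ j) →
    ∀ b : G.obj (F.obj y) ⟶ G.obj (F.obj (S.x α)),
      (∀ i, b ≫ G.map (F.map (S.δ α i)) = G.map (κ i)) →
      ∃! m : F.obj y ⟶ F.obj (S.x α), (∀ i, m ≫ F.map (S.δ α i) = κ i) ∧ G.map m = b

/-- The functor to the terminal category. -/
abbrev toPoint (D : Type v₁) [Category.{w₁} D] : D ⥤ Discrete PUnit.{u + 1} :=
  (Functor.const D).obj (Discrete.mk PUnit.unit)

/-- Over the point a filler is just a factorization through a limit cone. `D` may be large, so this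
applies to models. -/
theorem hasUniqueFillers_toPoint {F : S.Ob ⥤ D}
    (hF : ∀ α : S.A, Nonempty (IsLimit (F.mapCone (S.cone α).cone))) :
    HasUniqueFillers F (toPoint.{u} D) := by
  intro y α κ hκ b _
  obtain ⟨L⟩ := hF α
  let s : Cone (S.φ α ⋙ F) :=
    { pt := F.obj y
      π := { app := κ
             naturality := fun i j u => (Category.id_comp _).trans (hκ u).symm } }
  refine ⟨L.lift s, ⟨fun i => L.fac s i, Subsingleton.elim _ _⟩, ?_⟩
  rintro m ⟨hm, -⟩
  exact L.uniq s m hm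

end

/-! ### Right orthogonality to `Ξ` and unique fillers -/

section

variable {S} {D D' : Type u} [SmallCategory D] [SmallCategory D']

/-- The functor `E[y;α] ⥤ D` given by a cone in `D`. -/
def coinsDesc (F : S.Ob ⥤ D) {y : S.Ob} {α : S.A}
    (κ : ∀ i : S.I α, F.obj y ⟶ F.obj ((S.φ α).obj i))
    (hκ : ∀ {i j : S.I α} (u : i ⟶ j), κ i ≫ F.map ((S.φ α).map u) = κ j) :
    S.Coins y α ⥤ D :=
  Adjoin.desc F (fun {_ _} e => match e with | .γ i => κ i) (by
    rintro _ _ _ _ ⟨u⟩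
    rw [Functor.map_comp, Adjoin.pathsDesc_new, Adjoin.pathsDesc_old, Adjoin.pathsDesc_new]
    exact hκ u)

/-- The functor `E[y;α]' ⥤ D` given by a cone in `D` and a filler of it. -/
def fillDesc {y : S.Ob} {α : S.A} (i : S.Coins y α ⥤ D)
    (m : i.obj ((S.coinsIncl y α).obj y) ⟶ i.obj ((S.coinsIncl y α).obj (S.x α)))
    (hm : ∀ t, m ≫ i.map ((S.coinsIncl y α).map (S.δ α t)) =
      i.map (Adjoin.edge (S.CoinsRel y α) (CoinsEdge.γ t))) :
    S.Fill y α ⥤ D :=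
  Adjoin.desc i (fun {_ _} e => match e with | .γbar => m) (by
    rintro _ _ _ _ ⟨t⟩
    rw [Functor.map_comp, Adjoin.pathsDesc_new, Adjoin.pathsDesc_old, Adjoin.pathsDesc_old]
    exact hm t)

theorem fillIncl_fillDesc {y : S.Ob} {α : S.A} (i : S.Coins y α ⥤ D)
    (m : i.obj ((S.coinsIncl y α).obj y) ⟶ i.obj ((S.coinsIncl y α).obj (S.x α)))
    (hm : ∀ t, m ≫ i.map ((S.coinsIncl y α).map (S.δ α t)) =
      i.map (Adjoin.edge (S.CoinsRel y α) (CoinsEdge.γ t))) :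
    S.fillIncl y α ⋙ fillDesc i m hm = i :=
  Adjoin.incl_desc ..

/-- The added morphism `γbar` of `E[y;α]'`. -/
abbrev gammaBar (y : S.Ob) (α : S.A) :
    (S.fillIncl y α).obj ((S.coinsIncl y α).obj y) ⟶
      (S.fillIncl y α).obj ((S.coinsIncl y α).obj (S.x α)) :=
  Adjoin.edge (S.FillRel y α) FillEdge.γbar

theorem fillDesc_gammaBar {y : S.Ob} {α : S.A} (i : S.Coins y α ⥤ D)
    (m : i.obj ((S.coinsIncl y α).obj y) ⟶ i.obj ((S.coinsIncl y α).obj (S.x α)))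
    (hm : ∀ t, m ≫ i.map ((S.coinsIncl y α).map (S.δ α t)) =
      i.map (Adjoin.edge (S.CoinsRel y α) (CoinsEdge.γ t))) :
    (fillDesc i m hm).map (gammaBar y α) = m :=
  Adjoin.desc_edge ..

theorem gammaBar_comp (y : S.Ob) (α : S.A) (t : S.I α) :
    gammaBar y α ≫ (S.fillIncl y α).map ((S.coinsIncl y α).map (S.δ α t)) =
      (S.fillIncl y α).map (Adjoin.edge (S.CoinsRel y α) (CoinsEdge.γ t)) := by
  refine Eq.trans ?_ (CategoryTheory.Quotient.sound _ (AdjRel.rel _ _ (FillRel.fac t)))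
  exact (Functor.map_comp _ _ _).symm

theorem fill_functor_ext {y : S.Ob} {α : S.A} {H H' : S.Fill y α ⥤ D}
    (h : S.fillIncl y α ⋙ H = S.fillIncl y α ⋙ H')
    (he : H.map (gammaBar y α) ≍ H'.map (gammaBar y α)) : H = H' :=
  Adjoin.functor_ext h (by rintro _ _ ⟨⟩; exact he)

/-- A cone `κ` is a functor on `E[y;α]`, and a factorization `b` of its image is a functor on
`E[y;α]'`. They form a square from `r_{y,α}` to `g`, whose lifts correspond to fillers through their
value at `γbar`. -/
theorem hasUniqueFillers_of_orthRight {F : S.Ob ⥤ D} {F' : S.Ob ⥤ D'} (g : D ⥤ D')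
    (hg : F ⋙ g = F') (H : orthRight S.Xi (S.underHom g hg)) : HasUniqueFillers F g := by
  intro y α κ hκ b hb
  have HO := (uniquelyOrthogonal_underHom_iff (S.fillIncl y α) rfl g hg).1
    (H _ (MorphismProperty.ofHoms.mk (y, α)))
  let i := coinsDesc F κ hκ
  have hi : S.coinsIncl y α ⋙ i = F := Adjoin.incl_desc ..
  have hi' {a a' : S.Ob} (f : a ⟶ a') : i.map ((S.coinsIncl y α).map f) = F.map f :=
    Adjoin.desc_incl_map ..
  have hiγ (t : S.I α) : i.map (Adjoin.edge (S.CoinsRel y α) (CoinsEdge.γ t)) = κ t :=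
    Adjoin.desc_edge ..
  -- With `i` arbitrary, the equation between `i` and the restriction of the lift can be
  -- substituted, so no transport along equalities of objects appears.
  have key (i : S.Coins y α ⥤ D) (hi : S.coinsIncl y α ⋙ i = F)
      (b : g.obj (i.obj ((S.coinsIncl y α).obj y)) ⟶
        g.obj (i.obj ((S.coinsIncl y α).obj (S.x α))))
      (hb : ∀ t, b ≫ g.map (i.map ((S.coinsIncl y α).map (S.δ α t))) =
        g.map (i.map (Adjoin.edge (S.CoinsRel y α) (CoinsEdge.γ t)))) :
      ∃! m : i.obj ((S.coinsIncl y α).obj y) ⟶ i.obj ((S.coinsIncl y α).obj (S.x α)),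
        (∀ t, m ≫ i.map ((S.coinsIncl y α).map (S.δ α t)) =
          i.map (Adjoin.edge (S.CoinsRel y α) (CoinsEdge.γ t))) ∧ g.map m = b := by
    let j : S.Fill y α ⥤ D' := fillDesc (i ⋙ g) b hb
    have hj : S.fillIncl y α ⋙ j = i ⋙ g := fillIncl_fillDesc ..
    have hjb : j.map (gammaBar y α) = b := fillDesc_gammaBar ..
    obtain ⟨h, ⟨h₁, h₂⟩, hu⟩ := HO i j hi hj.symm
    subst h₁
    refine ⟨h.map (gammaBar y α), ⟨fun t => ?_, ?_⟩, ?_⟩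
    · exact (h.map_comp _ _).symm.trans (congrArg h.map (gammaBar_comp y α t))
    · rw [← hjb]
      exact (Functor.congr_hom h₂ (gammaBar y α)).trans
        ((Category.id_comp _).trans (Category.comp_id _))
    · rintro m ⟨hm, hmb⟩
      let h' := fillDesc (S.fillIncl y α ⋙ h) m hm
      have hh : S.fillIncl y α ⋙ h' = S.fillIncl y α ⋙ h := fillIncl_fillDesc ..
      have hm' : h'.map (gammaBar y α) = m := fillDesc_gammaBar ..
      have e : h' = h := by
        refine hu h' ⟨hh, fill_functor_ext ?_ ?_⟩
        · rw [← Functor.assoc, hh, hj]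
        · refine heq_of_eq ?_
          rw [hjb, ← hmb, ← hm']
          rfl
      rw [← hm']
      exact (Functor.congr_hom e (gammaBar y α)).trans
        ((Category.id_comp _).trans (Category.comp_id _))
  have := key i hi b (fun t => by rw [hi', hiγ]; exact hb t)
  simp only [hi', hiγ] at this
  exact this

/-- The filler of the cone `i(γ)` defines the lift on `γbar`. Any other lift sends `γbar` to a
filler of the same cone, and squares over the point commute automatically. -/
theorem orthRight_of_hasUniqueFillers_toPoint {F : S.Ob ⥤ D} {F' : S.Ob ⥤ Discrete PUnit.{u + 1}}
    (h : F ⋙ toPoint D = F') (hF : HasUniqueFillers F (toPoint.{u} D)) :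
    orthRight S.Xi (S.underHom (toPoint D) h) := by
  rintro _ _ _ ⟨⟨y, α⟩⟩
  refine (uniquelyOrthogonal_underHom_iff (S.fillIncl y α) rfl (toPoint D) h).2 ?_
  rintro i j rfl -
  obtain ⟨m, ⟨hm, -⟩, hu⟩ := hF y α
    (fun t => i.map (Adjoin.edge (S.CoinsRel y α) (CoinsEdge.γ t)))
    (fun {s t} f => by
      refine Eq.trans (i.map_comp _ _).symm (congrArg i.map ?_)
      refine Eq.trans ?_ (CategoryTheory.Quotient.sound _ (AdjRel.rel _ _ (CoinsRel.nat f)))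
      exact (Functor.map_comp _ _ _).symm)
    (𝟙 _) (fun _ => Subsingleton.elim _ _)
  refine ⟨fillDesc i m hm, ⟨fillIncl_fillDesc .., Functor.punit_ext' _ _⟩, ?_⟩
  rintro h' ⟨rfl, -⟩
  refine fill_functor_ext (fillIncl_fillDesc ..).symm (heq_of_eq ?_)
  refine Eq.trans ?_ (fillDesc_gammaBar (S.fillIncl y α ⋙ h') m hm).symm
  refine hu _ ⟨fun t => ?_, Subsingleton.elim _ _⟩
  exact (h'.map_comp _ _).symm.trans (congrArg h'.map (gammaBar_comp y α t))

end

end LimitSketch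

namespace LimitSketch

variable {S : LimitSketch.{u}}

/-! ### Functors out of `Fr(E)` -/

/-- The morphism of `Fr(E)` given by a meaningful expression. -/
def frMk {a b : S.Ob} (f : S.PreHom a b) (hf : S.Rel f f) :
    (FrOb.mk a : S.FrOb) ⟶ (FrOb.mk b : S.FrOb) :=
  Quotient.mk (S.frSetoid a b) ⟨f, hf⟩

theorem frMk_eq {a b : S.Ob} {f g : S.PreHom a b} (h : S.Rel f g) (hf : S.Rel f f)
    (hg : S.Rel g g) : frMk f hf = frMk g hg :=
  Quotient.sound (s := S.frSetoid a b) h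

theorem rel_of_frMk_eq {a b : S.Ob} {f g : S.PreHom a b} {hf : S.Rel f f} {hg : S.Rel g g}
    (h : frMk f hf = frMk g hg) : S.Rel f g :=
  Quotient.exact (s := S.frSetoid a b) h

theorem exists_frMk {a b : S.Ob} (q : (FrOb.mk a : S.FrOb) ⟶ FrOb.mk b) :
    ∃ (f : S.PreHom a b) (hf : S.Rel f f), frMk f hf = q := by
  induction q using Quotient.inductionOn with
  | h f => exact ⟨f.1, f.2, rfl⟩

/-- The filler in `Fr(E)` of a cone of meaningful expressions. -/
theorem frMk_lift_comp {α : S.A} {y : S.Ob} {κ : ∀ i : S.I α, S.PreHom y ((S.φ α).obj i)}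
    (hκ : ∀ i, S.Rel (κ i) (κ i))
    (hnat : ∀ {i j : S.I α} (u : i ⟶ j),
      S.Rel ((κ i).comp (PreHom.of ((S.φ α).map u))) (κ j)) (i : S.I α)
    (hl : S.Rel (PreHom.lift α κ) (PreHom.lift α κ)) :
    frMk (PreHom.lift α κ) hl ≫ S.lam.map (S.δ α i) = frMk (κ i) (hκ i) :=
  frMk_eq (Rel.fac α hκ hnat i) (Rel.comp hl (Rel.of _)) (hκ i)

/-- After choosing an expression for each leg, the cone equations become instances of `Rel`, since
equality in the quotient is `Rel`. They are the premises of the rules `lift` and `fac`; uniqueness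
is the rule `uniq`. -/
theorem isRealized_fr (S : LimitSketch.{u}) : S.Fr.IsRealized := by
  intro (α : S.A)
  have key (s : Cone (S.φ α ⋙ S.lam)) : ∃! m : s.pt ⟶ S.lam.obj (S.x α),
      ∀ i, m ≫ S.lam.map (S.δ α i) = s.π.app i := by
    choose κ hκ e using fun i => exists_frMk (a := s.pt.as) (s.π.app i)
    have hnat {i j : S.I α} (u : i ⟶ j) :
        S.Rel ((κ i).comp (PreHom.of ((S.φ α).map u))) (κ j) := by
      refine rel_of_frMk_eq (hf := Rel.comp (hκ i) (Rel.of _)) (hg := hκ j) ?_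
      rw [e j]
      refine Eq.trans ?_ (s.w u)
      rw [← e i]
      rfl
    have hl := Rel.lift (S := S) α hκ hnat
    refine ⟨frMk (S := S) (PreHom.lift α κ) hl, fun i => (frMk_lift_comp hκ hnat i hl).trans (e i), ?_⟩
    intro m hm
    obtain ⟨f, hf, rfl⟩ := exists_frMk (a := s.pt.as) (b := S.x α) m
    refine frMk_eq (Rel.uniq (S := S) α hf hl fun i => ?_) hf hl
    refine Rel.trans ?_ (Rel.fac (S := S) α hκ hnat i).symm
    exact rel_of_frMk_eq (hf := Rel.comp hf (Rel.of _)) (hg := hκ i) ((hm i).trans (e i).symm)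
  choose l hl hu using key
  exact ⟨{ lift := l, fac := hl, uniq := fun s m hm => hu s m hm }⟩

/-! ### The universal property of `Fr(E)`: uniqueness, then existence by partial evaluation -/

section

universe v₁ w₁ v₂ w₂

variable {D : Type v₁} [Category.{w₁} D] {D' : Type v₂} [Category.{w₂} D']

/-- Under unique fillers, functors out of `Fr(E)` are determined by their values on `E`. -/
theorem fr_functor_ext {G : D ⥤ D'} {H H' : S.FrOb ⥤ D} (hF : HasUniqueFillers (S.lam ⋙ H) G)
    (h : S.lam ⋙ H = S.lam ⋙ H') (hG : H ⋙ G = H' ⋙ G) : H = H' := by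
  obtain ⟨o, hm, hid, hcomp⟩ := H'
  obtain rfl : o = H.obj := (funext fun (a : S.FrOb) => Functor.congr_obj h a.as).symm
  have hof {a b : S.Ob} (f : a ⟶ b) : H.map (S.lam.map f) = hm (S.lam.map f) := by
    simpa using Functor.congr_hom h f
  have hG' {a b : S.FrOb} (f : a ⟶ b) : G.map (H.map f) = G.map (hm f) := by
    simpa using Functor.congr_hom hG f
  have hc {a b c : S.FrOb} (f : a ⟶ b) (g : b ⟶ c) : hm (f ≫ g) = hm f ≫ hm g := hcomp f g
  let P {a b : S.Ob} (f : S.PreHom a b) : Prop := ∀ hf, H.map (frMk f hf) = hm (frMk f hf)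
  have Pof {a b : S.Ob} (f : a ⟶ b) : P (PreHom.of f) := fun _ => hof f
  have Pcomp {a b c : S.Ob} {f : S.PreHom a b} {g : S.PreHom b c} (hf : S.Rel f f)
      (hg : S.Rel g g) (Pf : P f) (Pg : P g) : P (f.comp g) := by
    intro hfg
    change H.map (frMk f hf ≫ frMk g hg) = hm (frMk f hf ≫ frMk g hg)
    rw [H.map_comp, hc, Pf, Pg]
  have Plift {α : S.A} {y : S.Ob} {κ : ∀ i : S.I α, S.PreHom y ((S.φ α).obj i)}
      (hκ : ∀ i, S.Rel (κ i) (κ i))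
      (hnat : ∀ {i j : S.I α} (u : i ⟶ j),
        S.Rel ((κ i).comp (PreHom.of ((S.φ α).map u))) (κ j))
      (Pκ : ∀ i, P (κ i)) : P (PreHom.lift α κ) := by
    intro hl
    -- Both functors send the filler to a filler of the same cone over the same morphism of `D'`.
    refine (hF y α (fun i => H.map (frMk (κ i) (hκ i))) ?_ (G.map (H.map (frMk _ hl))) ?_).unique
      ⟨?_, rfl⟩ ⟨?_, (hG' _).symm⟩
    · intro i j u
      refine (H.map_comp _ _).symm.trans (congrArg H.map ?_)
      exact frMk_eq (hnat u) (Rel.comp (hκ i) (Rel.of _)) (hκ j)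
    · intro i
      refine (G.map_comp _ _).symm.trans (congrArg G.map ?_)
      refine (H.map_comp _ _).symm.trans (congrArg H.map ?_)
      exact frMk_lift_comp hκ hnat i hl
    · intro i
      refine (H.map_comp _ _).symm.trans (congrArg H.map ?_)
      exact frMk_lift_comp hκ hnat i hl
    · intro i
      change _ ≫ H.map (S.lam.map _) = _
      rw [hof]
      refine (hc _ _).symm.trans (Eq.trans ?_ (Pκ i (hκ i)).symm)
      exact congrArg hm (frMk_lift_comp hκ hnat i hl)
  -- Induction on derivations rather than on expressions: the premises of each rule supply the
  -- meaningfulness of subexpressions, which cannot be read off `Rel f f` directly.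
  have main {a b : S.Ob} {f g : S.PreHom a b} (hfg : S.Rel f g) : P f ∧ P g := by
    induction hfg with
    | symm _ ih => exact ih.symm
    | trans _ _ ih ih' => exact ⟨ih.1, ih'.2⟩
    | of f => exact ⟨Pof f, Pof f⟩
    | comp h h' ih ih' =>
      exact ⟨Pcomp (h.trans h.symm) (h'.trans h'.symm) ih.1 ih'.1,
        Pcomp (h.symm.trans h) (h'.symm.trans h') ih.2 ih'.2⟩
    | id_comp h ih => exact ⟨Pcomp (Rel.of _) h (Pof _) ih.1, ih.1⟩
    | comp_id h ih => exact ⟨Pcomp h (Rel.of _) ih.1 (Pof _), ih.1⟩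
    | assoc h₁ h₂ h₃ ih₁ ih₂ ih₃ =>
      exact ⟨Pcomp (Rel.comp h₁ h₂) h₃ (Pcomp h₁ h₂ ih₁.1 ih₂.1) ih₃.1,
        Pcomp h₁ (Rel.comp h₂ h₃) ih₁.1 (Pcomp h₂ h₃ ih₂.1 ih₃.1)⟩
    | of_comp f g => exact ⟨Pof _, Pcomp (Rel.of _) (Rel.of _) (Pof _) (Pof _)⟩
    | lift α h hnat ih ih' =>
      refine ⟨Plift (fun i => (h i).trans (h i).symm) hnat fun i => (ih i).1,
        Plift (fun i => (h i).symm.trans (h i)) (fun {i j} u => ?_) fun i => (ih i).2⟩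
      exact (Rel.comp (h i).symm (Rel.of _)).trans ((hnat u).trans (h j))
    | fac α h hnat i ih ih' =>
      exact ⟨Pcomp (Rel.lift α h hnat) (Rel.of _) (Plift h hnat fun i => (ih i).1) (Pof _),
        (ih i).1⟩
    | uniq α _ _ _ ih ih' _ => exact ⟨ih.1, ih'.1⟩
  refine CategoryTheory.Functor.ext (fun _ => rfl) ?_
  rintro ⟨a⟩ ⟨b⟩ q
  obtain ⟨f, hf, rfl⟩ := exists_frMk q
  simpa using (main hf).1 hf

/-- Partial evaluation of raw expressions in `D`, relative to `G` and to a given map from the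
morphisms of `Fr(E)` to those of `D'`. -/
def Eval (F : S.Ob ⥤ D) (G : D ⥤ D')
    (jm : ∀ {a b : S.Ob}, ((FrOb.mk a : S.FrOb) ⟶ FrOb.mk b) →
      (G.obj (F.obj a) ⟶ G.obj (F.obj b))) :
    ∀ {a b : S.Ob}, S.PreHom a b → (F.obj a ⟶ F.obj b) → Prop
  | _, _, .of f, m => m = F.map f
  | _, _, .comp f g, m => ∃ m₁ m₂, Eval F G jm f m₁ ∧ Eval F G jm g m₂ ∧ m = m₁ ≫ m₂
  -- The legs alone need not determine `m`: fillers are unique only over a prescribed image in `D'`,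
  -- so the image is prescribed as well.
  | _, _, .lift α κ, m => (∀ i, Eval F G jm (κ i) (m ≫ F.map (S.δ α i))) ∧
      ∃ h : S.Rel (PreHom.lift α κ) (PreHom.lift α κ), G.map m = jm (frMk _ h)

/-- The universal property of `Fr(E)`. -/
theorem existsUnique_fr_functor {F : S.Ob ⥤ D} {G : D ⥤ D'} (hF : HasUniqueFillers F G)
    (J : S.FrOb ⥤ D') (hJ : S.lam ⋙ J = F ⋙ G) :
    ∃! H : S.FrOb ⥤ D, S.lam ⋙ H = F ∧ H ⋙ G = J := by
  refine existsUnique_of_exists_of_unique ?_ ?_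
  swap
  · rintro H H' ⟨rfl, h₂⟩ ⟨h₁', h₂'⟩
    exact fr_functor_ext hF h₁'.symm (h₂.trans h₂'.symm)
  obtain ⟨jo, jm, jid, jcomp⟩ := J
  obtain rfl : jo = fun a => G.obj (F.obj a.as) := funext fun (a : S.FrOb) => Functor.congr_obj hJ a.as
  have jof {a b : S.Ob} (f : a ⟶ b) : jm (S.lam.map f) = G.map (F.map f) := by
    exact (Functor.congr_hom hJ f).trans ((Category.id_comp _).trans (Category.comp_id _))
  have jc {a b c : S.FrOb} (f : a ⟶ b) (g : b ⟶ c) : jm (f ≫ g) = jm f ≫ jm g := jcomp f g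
  -- `E f m`: the evaluation of `f` is defined with `m` as its only value, and `m` lies over the
  -- image of the class of `f`. The second clause provides the prescribed factorization for fillers
  -- and finally gives `H ⋙ G = J`.
  let E {a b : S.Ob} (f : S.PreHom a b) (m : F.obj a ⟶ F.obj b) : Prop :=
    (∀ m', Eval F G (fun q => jm q) f m' ↔ m' = m) ∧ ∀ hf, jm (frMk f hf) = G.map m
  have Eu {a b : S.Ob} {f : S.PreHom a b} {m n : F.obj a ⟶ F.obj b} (hm : E f m) (hn : E f n) :
      m = n := (hn.1 m).1 ((hm.1 m).2 rfl)
  have Eof {a b : S.Ob} (f : a ⟶ b) : E (PreHom.of f) (F.map f) :=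
    ⟨fun m' => by rw [Eval], fun _ => jof f⟩
  have Ecomp {a b c : S.Ob} {f : S.PreHom a b} {g : S.PreHom b c} (hf : S.Rel f f)
      (hg : S.Rel g g) {m : F.obj a ⟶ F.obj b} {n : F.obj b ⟶ F.obj c} (hm : E f m)
      (hn : E g n) : E (f.comp g) (m ≫ n) := by
    refine ⟨fun m' => ?_, fun hfg => ?_⟩
    · rw [Eval]
      constructor
      · rintro ⟨m₁, m₂, h₁, h₂, rfl⟩
        rw [(hm.1 _).1 h₁, (hn.1 _).1 h₂]
      · rintro rfl
        exact ⟨m, n, (hm.1 _).2 rfl, (hn.1 _).2 rfl, rfl⟩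
    · rw [G.map_comp, ← hm.2 hf, ← hn.2 hg]
      exact jc (frMk f hf) (frMk g hg)
  have Elift {α : S.A} {y : S.Ob} {κ : ∀ i : S.I α, S.PreHom y ((S.φ α).obj i)}
      (hκ : ∀ i, S.Rel (κ i) (κ i))
      (hnat : ∀ {i j : S.I α} (u : i ⟶ j),
        S.Rel ((κ i).comp (PreHom.of ((S.φ α).map u))) (κ j))
      {k : ∀ i, F.obj y ⟶ F.obj ((S.φ α).obj i)} (hk : ∀ i, E (κ i) (k i))
      (hn : ∀ {i j : S.I α} (u : i ⟶ j), k i ≫ F.map ((S.φ α).map u) = k j) :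
      ∃ m, E (PreHom.lift α κ) m ∧ ∀ i, m ≫ F.map (S.δ α i) = k i := by
    have hl := Rel.lift α hκ hnat
    obtain ⟨m, ⟨hm, hmb⟩, hu⟩ := hF y α k hn (jm (frMk _ hl)) (fun i => by
      rw [← jof, ← (hk i).2 (hκ i)]
      exact (jc _ _).symm.trans (congrArg jm (frMk_lift_comp hκ hnat i hl)))
    refine ⟨m, ⟨fun m' => ?_, fun _ => hmb.symm⟩, hm⟩
    rw [Eval]
    constructor
    · rintro ⟨h, _, hb⟩
      exact hu m' ⟨fun i => ((hk i).1 _).1 (h i), hb⟩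
    · rintro rfl
      exact ⟨fun i => ((hk i).1 _).2 (hm i), hl, hmb⟩
  -- Soundness: related expressions both evaluate, and to the same value.
  have main {a b : S.Ob} {f g : S.PreHom a b} (hfg : S.Rel f g) : ∃ m, E f m ∧ E g m := by
    induction hfg with
    | symm _ ih => exact ih.imp fun _ h => h.symm
    | trans _ _ ih ih' =>
      obtain ⟨m, hf, hg⟩ := ih
      obtain ⟨n, hg', hh⟩ := ih'
      obtain rfl := Eu hg hg'
      exact ⟨m, hf, hh⟩
    | of f => exact ⟨_, Eof f, Eof f⟩
    | comp h h' ih ih' =>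
      obtain ⟨m, hf, hf'⟩ := ih
      obtain ⟨n, hg, hg'⟩ := ih'
      exact ⟨m ≫ n, Ecomp (h.trans h.symm) (h'.trans h'.symm) hf hg,
        Ecomp (h.symm.trans h) (h'.symm.trans h') hf' hg'⟩
    | id_comp h ih =>
      obtain ⟨m, hf, -⟩ := ih
      exact ⟨m, by simpa using Ecomp (Rel.of _) h (Eof (𝟙 _)) hf, hf⟩
    | comp_id h ih =>
      obtain ⟨m, hf, -⟩ := ih
      exact ⟨m, by simpa using Ecomp h (Rel.of _) hf (Eof (𝟙 _)), hf⟩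
    | assoc h₁ h₂ h₃ ih₁ ih₂ ih₃ =>
      obtain ⟨m₁, e₁, -⟩ := ih₁
      obtain ⟨m₂, e₂, -⟩ := ih₂
      obtain ⟨m₃, e₃, -⟩ := ih₃
      refine ⟨m₁ ≫ m₂ ≫ m₃, ?_, Ecomp h₁ (Rel.comp h₂ h₃) e₁ (Ecomp h₂ h₃ e₂ e₃)⟩
      rw [← Category.assoc]
      exact Ecomp (Rel.comp h₁ h₂) h₃ (Ecomp h₁ h₂ e₁ e₂) e₃
    | of_comp f g =>
      refine ⟨_, Eof _, ?_⟩
      rw [F.map_comp]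
      exact Ecomp (Rel.of _) (Rel.of _) (Eof _) (Eof _)
    | lift α h hnat ih ih' =>
      choose k hk hk' using ih
      have hκ i := (h i).trans (h i).symm
      have hκ' i := (h i).symm.trans (h i)
      have hn {i j : S.I α} (u : i ⟶ j) : k i ≫ F.map ((S.φ α).map u) = k j := by
        obtain ⟨m, e, e'⟩ := ih' u
        rw [Eu (hk j) e', Eu e (Ecomp (hκ i) (Rel.of _) (hk i) (Eof _))]
      have hnat' {i j : S.I α} (u : i ⟶ j) :=
        (Rel.comp (h i).symm (Rel.of ((S.φ α).map u))).trans ((hnat u).trans (h j))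
      obtain ⟨m, hm, hmk⟩ := Elift hκ hnat hk hn
      obtain ⟨m', hm', hmk'⟩ := Elift hκ' hnat' hk' hn
      have hl := Rel.lift α h hnat
      -- Both fill the cone `k`, and they have the same image in `D'` because the two lifts are
      -- equal in `Fr(E)`.
      obtain rfl : m = m' := by
        refine (hF _ α k hn (G.map m) fun i => ?_).unique ⟨hmk, rfl⟩ ⟨hmk', ?_⟩
        · rw [← hmk i, G.map_comp]
        · rw [← hm.2 (hl.trans hl.symm), ← hm'.2 (hl.symm.trans hl)]
          exact congrArg jm (frMk_eq hl.symm _ _)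
      exact ⟨m, hm, hm'⟩
    | fac α hκ hnat i ih ih' =>
      choose k hk _ using ih
      have hn {i j : S.I α} (u : i ⟶ j) : k i ≫ F.map ((S.φ α).map u) = k j := by
        obtain ⟨m, e, e'⟩ := ih' u
        rw [Eu (hk j) e', Eu e (Ecomp (hκ i) (Rel.of _) (hk i) (Eof _))]
      obtain ⟨m, hm, hmk⟩ := Elift hκ hnat hk hn
      refine ⟨k i, ?_, hk i⟩
      rw [← hmk i]
      exact Ecomp (Rel.lift α hκ hnat) (Rel.of _) hm (Eof _)
    | @uniq α y f g h h' hδ ih ih' ihδ =>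
      obtain ⟨m, hm, -⟩ := ih
      obtain ⟨n, hn, -⟩ := ih'
      -- Both fill the cone with legs `m ≫ F.map (S.δ α i)`: the premise on legs gives equal legs,
      -- and the equality of the classes of `f` and `g` in `Fr(E)` gives equal images in `D'`.
      obtain rfl : m = n := by
        refine (hF _ α (fun i => m ≫ F.map (S.δ α i)) (fun u => ?_) (G.map m) fun i => ?_).unique
          ⟨fun _ => rfl, rfl⟩ ⟨fun i => ?_, ?_⟩
        · rw [Category.assoc, ← F.map_comp, (S.cone α).cone.w]
        · rw [G.map_comp]
        · obtain ⟨k, e, e'⟩ := ihδ i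
          rw [Eu (Ecomp h' (Rel.of _) hn (Eof _)) e', Eu e (Ecomp h (Rel.of _) hm (Eof _))]
        · rw [← hm.2 h, ← hn.2 h']
          exact congrArg jm (frMk_eq (Rel.uniq α h' h fun i => (hδ i).symm) _ _)
      exact ⟨m, hm, hn⟩
  -- The value depends only on the class of an expression, so evaluation descends to the morphisms
  -- of `Fr(E)`.
  have hval (a b : S.Ob) (q : (FrOb.mk a : S.FrOb) ⟶ FrOb.mk b) :
      ∃ m, ∀ f hf, frMk f hf = q → E f m := by
    obtain ⟨f, hf, rfl⟩ := exists_frMk q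
    obtain ⟨m, hm, -⟩ := main hf
    refine ⟨m, fun g hg e => ?_⟩
    obtain ⟨n, hn, hn'⟩ := main (rel_of_frMk_eq e)
    rwa [Eu hm hn']
  choose v hv using hval
  let H : S.FrOb ⥤ D :=
    { obj := fun a => F.obj a.as
      map := fun {a b} q => v a.as b.as q
      map_id := fun a =>
        (Eu (hv _ _ _ _ (Rel.of (𝟙 a.as)) rfl) (Eof _)).trans (F.map_id _)
      map_comp := fun {a b c} p q => by
        obtain ⟨f, hf, rfl⟩ := exists_frMk (a := a.as) (b := b.as) p
        obtain ⟨g, hg, rfl⟩ := exists_frMk (a := b.as) (b := c.as) q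
        exact Eu (hv _ _ _ _ (Rel.comp hf hg) rfl)
          (Ecomp hf hg (hv _ _ _ f hf rfl) (hv _ _ _ g hg rfl)) }
  refine ⟨H, CategoryTheory.Functor.ext (fun _ => rfl) fun a b f => ?_,
    CategoryTheory.Functor.ext (fun _ => rfl) ?_⟩
  · exact (Eu (hv _ _ _ _ (Rel.of f) rfl) (Eof f)).trans
      ((Category.id_comp _).trans (Category.comp_id _)).symm
  · rintro ⟨a⟩ ⟨b⟩ q
    obtain ⟨f, hf, rfl⟩ := exists_frMk q
    simpa using ((hv _ _ _ f hf rfl).2 hf).symm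

end

/-! ### The factorization and the extension of models -/

theorem hasUniqueFillers_lam (S : LimitSketch.{u}) :
    HasUniqueFillers S.lam (toPoint.{u} S.FrOb) :=
  hasUniqueFillers_toPoint S.isRealized_fr

/-- The source of `λ_!` is the initial object `1_E`, so the top of any square is the structure
functor of its target. A lift is then exactly what the universal property of `Fr(E)` provides. -/
theorem orthLeft_lamMap (S : LimitSketch.{u}) : orthLeft (orthRight S.Xi) S.lamMap := by
  intro a b g hg
  have hw : a.hom.toFunctor ⋙ g.right.toFunctor = b.hom.toFunctor :=
    congrArg (fun t => t.toFunctor) (Under.w g)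
  have hF : HasUniqueFillers a.hom.toFunctor g.right.toFunctor :=
    hasUniqueFillers_of_orthRight g.right.toFunctor hw hg
  refine (uniquelyOrthogonal_underHom_iff S.lam (Functor.id_comp _) g.right.toFunctor hw).2 ?_
  rintro i j hi hij
  obtain rfl : i = a.hom.toFunctor := (Functor.id_comp i).symm.trans hi
  exact existsUnique_fr_functor hF j hij.symm

/-- A model has a unique extension along `λ_!`. -/
theorem existsUnique_extension (X : S.Mod) : ∃! H : S.FrOb ⥤ Type u, S.lam ⋙ H = X.obj := by
  obtain ⟨H, ⟨hH, -⟩, hu⟩ := existsUnique_fr_functor (hasUniqueFillers_toPoint X.property)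
    (toPoint.{u} S.FrOb) rfl
  exact ⟨H, hH, fun H' h => hu H' ⟨h, Functor.punit_ext' _ _⟩⟩

/-- The extension of a model of `E` to a model of `Fr(E)`. -/
noncomputable def extend (X : S.Mod) : S.Fr.Mod where
  obj := (existsUnique_extension X).choose
  property α := by
    have h : S.IsModel (S.lam ⋙ (existsUnique_extension X).choose) := by
      rw [(existsUnique_extension X).choose_spec.1]
      exact X.property
    -- The extension applied to the cone `λ_! C_α` is its restriction along `λ_!` applied to `C_α`,
    -- by definition.
    exact h α

theorem lam_comp_extend (X : S.Mod) : S.lam ⋙ (extend X).obj = X.obj :=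
  (existsUnique_extension X).choose_spec.1

theorem eq_extend (X : S.Mod) (G : S.FrOb ⥤ Type u) (h : S.lam ⋙ G = X.obj) :
    G = (extend X).obj :=
  (existsUnique_extension X).choose_spec.2 G h

theorem extend_lamStar (M : S.Fr.Mod) : extend (S.lamStar M) = M :=
  ObjectProperty.FullSubcategory.ext (eq_extend (S.lamStar M) M.obj rfl).symm

theorem lamStar_extend (X : S.Mod) : S.lamStar (extend X) = X :=
  ObjectProperty.FullSubcategory.ext (lam_comp_extend X)

end LimitSketch

theorem mainTheorem4 (S : LimitSketch.{u}) :
    -- `E ⟶ Fr(E) ⟶ *` is the factorization of the terminal map in `E/Cat` generated by `Ξ`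
    (orthLeft (orthRight S.Xi) S.lamMap ∧ orthRight S.Xi S.frToTerminal) ∧
    S.Fr.IsRealized ∧
    -- `λ_!^*` is a bijection from models of `Fr(E)` to models of `E`
    Function.Bijective S.lamStar ∧
    -- the inverse sends a model to its unique extension along `λ_!`
    ∃ Φ : S.Mod → S.Fr.Mod,
      Function.LeftInverse Φ S.lamStar ∧ Function.RightInverse Φ S.lamStar ∧
      ∀ X : S.Mod, S.lam ⋙ (Φ X).obj = X.obj ∧
        ∀ G : S.FrOb ⥤ Type u, S.lam ⋙ G = X.obj → G = (Φ X).obj :=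
  ⟨⟨S.orthLeft_lamMap,
      LimitSketch.orthRight_of_hasUniqueFillers_toPoint rfl S.hasUniqueFillers_lam⟩,
    S.isRealized_fr,
    Function.bijective_iff_has_inverse.2
      ⟨LimitSketch.extend, LimitSketch.extend_lamStar, LimitSketch.lamStar_extend⟩,
    LimitSketch.extend, LimitSketch.extend_lamStar, LimitSketch.lamStar_extend,
    fun X => ⟨LimitSketch.lam_comp_extend X, LimitSketch.eq_extend X⟩⟩
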